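/- For a topological space $Y$, let $\dim Y$ be its Lebesgue covering dimension: the least integer $n$ such that every open cover of $Y$ has an open refinement covering $Y$ in which no point of $Y$ lies in more than $n+1$ members ($\dim Y=\infty$ if there is no such $n$). The compact topological dimension of a space $X$ is $$\dim_c X=\sup\{\dim K : K\subset X \text{ compact}\},$$ where each $K$ carries the subspace topology. Let $X$ be a contractible Hausdorff space with $\dim_c X=n<\infty$. Let $A_1,\dots,A_m$ be a finite collection of subsets of $X$, each contractible in its subspace topology, such that the intersection $\bigcap_{i\in I}A_i$ over every nonempty $I\subset\{1,\dots,m\}$ is either contractible or empty. Suppose that $m\ge n+2$ and that $\bigcap_{i\in I}A_i\neq\emptyset$ for every $I\subset\{1,\dots,m\}$ with $|I|=n+1$. Then $$\bigcap_{i=1}^m A_i\neq\emptyset.$$ -/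

import Mathlib

/-- Every open cover `𝒰` of `X` has an open refinement `𝒱` (again a cover of `X`) of multiplicity
at most `n + 1`: no point of `X` lies in more than `n + 1` members of `𝒱`. For a nonempty space
this says that the Lebesgue covering dimension of `X` is at most `n`. -/
def CoveringDimLE (X : Type*) [TopologicalSpace X] (n : ℕ) : Prop :=
  ∀ 𝒰 : Set (Set X), (∀ U ∈ 𝒰, IsOpen U) → ⋃₀ 𝒰 = Set.univ →
    ∃ 𝒱 : Set (Set X), (∀ V ∈ 𝒱, IsOpen V) ∧ ⋃₀ 𝒱 = Set.univ ∧
      (∀ V ∈ 𝒱, ∃ U ∈ 𝒰, V ⊆ U) ∧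
      ∀ x : X, {V ∈ 𝒱 | x ∈ V}.encard ≤ ((n + 1 : ℕ) : ℕ∞)

open Classical in
/-- The Lebesgue covering dimension of `X`: the least `n` with `CoveringDimLE X n`, and `⊤` if there
is none. The empty space has dimension `⊥` (which plays the role of the conventional `-1`). -/
noncomputable def coveringDim (X : Type*) [TopologicalSpace X] : WithBot ℕ∞ :=
  if IsEmpty X then ⊥ else ⨅ (n : ℕ) (_ : CoveringDimLE X n), ((n : ℕ∞) : WithBot ℕ∞)

/-- The compact topological dimension of `X`: the supremum of the covering dimensions of the compact
subsets of `X`, with their subspace topologies. -/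
noncomputable def compactTopDim (X : Type*) [TopologicalSpace X] : WithBot ℕ∞ :=
  ⨆ (K : Set X) (_ : IsCompact K), coveringDim K

/-! By induction on its size, every subfamily has a common point. Up to `n + 1` sets this is the
hypothesis on subfamilies of size `n + 1`. For `k ≥ n + 2` sets, all proper subfamilies have
nonempty, hence contractible, intersections, the empty subfamily giving `X` itself.

Suppose the `k` sets had no common point. Attach to each face `I` of the simplex the intersection of
the `A i` with `i ∉ I`. These sets are contractible and grow with `I`, so
`exists_continuousMap_mem_carrier` gives a map `f` of the simplex into `X`, built face by face, that
sends the `i`-th facet into `A i`. In the compact image `K` the complements of the images of the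
facets form an open cover. Since `K` has dimension at most `n` and `k ≥ n + 2`, this cover shrinks
to one whose members have no common point (`CoveringDimLE.exists_shrinking`). Pulled back along `f`,
it contradicts the KKM-type theorem `stdSimplex_inter_nonempty_of_open_cover`.

The KKM-type theorem comes from Scarf's lemma `exists_dominant_rainbow` applied to fine grids:
dominant sets take the place of the cells of a triangulation, and the usual parity argument of
Sperner's lemma runs on them. -/

/-! ### Dominant sets and their replacement property. -/

/-- With respect to the rankings `r i`, the finite set `P` is dominant if no point of `V` lies, for
every `i`, strictly above the `r i`-least point of `P`. -/
def Dominant {V I : Type*} (r : I → V → ℕ) (P : Finset V) : Prop :=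
  ∀ y, ∃ i, ∀ x ∈ P, r i y ≤ r i x

theorem Dominant.mono {V I : Type*} {r : I → V → ℕ} {P Q : Finset V} (hP : Dominant r P)
    (h : Q ⊆ P) : Dominant r Q := fun y => by
  obtain ⟨i, hi⟩ := hP y
  exact ⟨i, fun x hx => hi x (h hx)⟩

section Replacement

variable {V I : Type*} {r : I → V → ℕ}

theorem exists_rank_argmin (r : I → V → ℕ) {P : Finset V} (hP : P.Nonempty) :
    ∃ p : I → V, ∀ i, p i ∈ P ∧ ∀ x ∈ P, r i (p i) ≤ r i x := by
  choose p hp using fun i => Finset.exists_min_image P (r i) hP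
  exact ⟨p, hp⟩

/-- Dominance tested at `x` itself yields a ranking in which `x` is least. -/
theorem Dominant.argmin_surj (hr : ∀ i, Function.Injective (r i)) {P : Finset V}
    (hP : Dominant r P) {p : I → V} (hp : ∀ i, p i ∈ P ∧ ∀ x ∈ P, r i (p i) ≤ r i x)
    {x : V} (hx : x ∈ P) : ∃ i, p i = x := by
  obtain ⟨i, hi⟩ := hP x
  exact ⟨i, hr i (le_antisymm ((hp i).2 x hx) (hi _ (hp i).1))⟩

variable [DecidableEq V] [Fintype I]

/-- A point completing a set with one element too few to a dominant set is the highest one in the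
ranking `k` among those above the set in all other rankings, for one of the two indices `k` at which
the least elements coincide. -/
theorem Dominant.insert_spec (hr : ∀ i, Function.Injective (r i)) {P : Finset V}
    (hcard : P.card + 1 = Fintype.card I) {p : I → V}
    (hp : ∀ i, p i ∈ P ∧ ∀ x ∈ P, r i (p i) ≤ r i x) {i j : I} (hij : i ≠ j) (hpij : p i = p j)
    {y : V} (hy : y ∉ P) (hD : Dominant r (insert y P)) :
    ∃ k, (k = i ∨ k = j) ∧ (∀ l, l ≠ k → r l (p l) < r l y) ∧
      ∀ w, (∀ l, l ≠ k → r l (p l) < r l w) → r k w ≤ r k y := by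
  obtain ⟨q, hq⟩ := exists_rank_argmin r (Finset.insert_nonempty y P)
  -- `q` maps onto `insert y P`, which has as many elements as `I`, so `q` is a bijection. Hence `y`
  -- is least in exactly one ranking `k`, and the other least elements are those of `P`.
  have hqinj : Set.InjOn q (Finset.univ : Finset I) :=
    Finset.injOn_of_surjOn_of_card_le (t := insert y P) q (fun l _ => (hq l).1)
      (fun x hx => by
        obtain ⟨l, hl⟩ := hD.argmin_surj hr hq (Finset.mem_coe.1 hx)
        exact ⟨l, Finset.mem_coe.2 (Finset.mem_univ _), hl⟩)
      (by rw [Finset.card_insert_of_notMem hy, Finset.card_univ, hcard])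
  have hqinj' : Function.Injective q := fun a b h => hqinj (by simp) (by simp) h
  obtain ⟨k, hk⟩ := hD.argmin_surj hr hq (Finset.mem_insert_self y P)
  have hqp : ∀ l, l ≠ k → q l = p l := fun l hl => by
    have h1 : q l ≠ y := fun h => hl (hqinj' (h.trans hk.symm))
    have h2 : q l ∈ P := (Finset.mem_insert.1 (hq l).1).resolve_left h1
    exact hr l (le_antisymm ((hq l).2 _ (Finset.mem_insert_of_mem (hp l).1)) ((hp l).2 _ h2))
  refine ⟨k, ?_, fun l hl => ?_, fun w hw => ?_⟩
  · by_contra hcon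
    push Not at hcon
    exact hij (hqinj' (by rw [hqp i hcon.1.symm, hqp j hcon.2.symm, hpij]))
  · refine lt_of_le_of_ne ?_ fun h => hy (hr l h ▸ (hp l).1)
    rw [← hqp l hl]
    exact (hq l).2 y (Finset.mem_insert_self y P)
  · obtain ⟨l, hl⟩ := hD w
    by_cases hlk : l = k
    · subst hlk
      exact hl y (Finset.mem_insert_self y P)
    · exact absurd (hl _ (Finset.mem_insert_of_mem (hp l).1)) (not_le.2 (hw l hlk))

/-- At an index `k` where the least elements coincide, a dominant set can be completed as soon as
some point lies above it in all other rankings. -/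
theorem Dominant.exists_insert [Fintype V] (hr : ∀ i, Function.Injective (r i)) {P : Finset V}
    (hP : Dominant r P) {p : I → V} (hp : ∀ i, p i ∈ P ∧ ∀ x ∈ P, r i (p i) ≤ r i x)
    {k j : I} (hkj : k ≠ j) (hpkj : p k = p j) (hM : ∃ y, ∀ l, l ≠ k → ∃ x ∈ P, r l x < r l y) :
    ∃ y, y ∉ P ∧ Dominant r (insert y P) ∧ (∀ l, l ≠ k → r l (p l) < r l y) ∧
      r k y ≤ r k (p k) ∧ ∀ w, (∀ l, l ≠ k → r l (p l) < r l w) → r k w ≤ r k y := by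
  classical
  let S : Finset V := Finset.univ.filter fun y => ∀ l, l ≠ k → r l (p l) < r l y
  have hS : S.Nonempty := by
    obtain ⟨y, hy⟩ := hM
    refine ⟨y, Finset.mem_filter.2 ⟨Finset.mem_univ _, fun l hl => ?_⟩⟩
    obtain ⟨x, hx, hxy⟩ := hy l hl
    exact ((hp l).2 x hx).trans_lt hxy
  obtain ⟨y, hyS, hmax⟩ := Finset.exists_max_image S (r k) hS
  have hy : ∀ l, l ≠ k → r l (p l) < r l y := (Finset.mem_filter.1 hyS).2
  have hbelow : ∀ x ∈ P, r k y ≤ r k x := by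
    obtain ⟨l, hl⟩ := hP y
    by_cases hlk : l = k
    · exact hlk ▸ hl
    · exact absurd (hl _ (hp l).1) (not_le.2 (hy l hlk))
  have hmax' : ∀ w, (∀ l, l ≠ k → r l (p l) < r l w) → r k w ≤ r k y := fun w hw =>
    hmax w (Finset.mem_filter.2 ⟨Finset.mem_univ _, hw⟩)
  refine ⟨y, fun hyP => ?_, fun w => ?_, hy, hbelow _ (hp k).1, hmax'⟩
  -- A point of `P` this low in ranking `k` is `p k = p j`, yet `y` lies strictly above `p j` in
  -- ranking `j`.
  · have h : y = p k := hr k (le_antisymm (hbelow _ (hp k).1) ((hp k).2 y hyP))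
    exact absurd (hy j hkj.symm) (by rw [h, hpkj]; exact lt_irrefl _)
  · by_cases hw : ∀ l, l ≠ k → r l (p l) < r l w
    · refine ⟨k, fun x hx => ?_⟩
      rcases Finset.mem_insert.1 hx with rfl | hx
      · exact hmax' w hw
      · exact (hmax' w hw).trans (hbelow x hx)
    · push Not at hw
      obtain ⟨l, hlk, hl⟩ := hw
      refine ⟨l, fun x hx => ?_⟩
      rcases Finset.mem_insert.1 hx with rfl | hx
      · exact hl.trans (hy l hlk).le
      · exact hl.trans ((hp l).2 x hx)

/-- A dominant set with one element too few has exactly two completions, provided that for every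
ranking there is a point above it in all other rankings. -/
theorem Dominant.card_insert_eq_two [Fintype V] (hr : ∀ i, Function.Injective (r i)) {P : Finset V}
    (hne : P.Nonempty) (hcard : P.card + 1 = Fintype.card I) (hP : Dominant r P)
    (hM : ∀ k, ∃ y, ∀ l, l ≠ k → ∃ x ∈ P, r l x < r l y) (R : Finset V)
    (hR : ∀ y, y ∈ R ↔ y ∉ P ∧ Dominant r (insert y P)) : R.card = 2 := by
  obtain ⟨p, hp⟩ := exists_rank_argmin r hne
  obtain ⟨i, -, j, -, hij, hpij⟩ := Finset.exists_ne_map_eq_of_card_lt_of_maps_to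
    (s := (Finset.univ : Finset I)) (t := P) (f := p)
    (by rw [Finset.card_univ]; omega) (fun l _ => (hp l).1)
  obtain ⟨y, hyP, hyD, hy, hyi, hymax⟩ := hP.exists_insert hr hp hij hpij (hM i)
  obtain ⟨z, hzP, hzD, hz, hzj, hzmax⟩ := hP.exists_insert hr hp hij.symm hpij.symm (hM j)
  have hyz : y ≠ z := by
    rintro rfl
    exact absurd (hy j hij.symm) (not_lt.2 hzj)
  rw [Finset.card_eq_two]
  refine ⟨y, z, hyz, Finset.ext fun w => ?_⟩
  rw [hR, Finset.mem_insert, Finset.mem_singleton]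
  constructor
  · rintro ⟨hwP, hwD⟩
    obtain ⟨k, rfl | rfl, hw, hwmax⟩ := hwD.insert_spec hr hcard hp hij hpij hwP
    · exact Or.inl (hr _ (le_antisymm (hymax w hw) (hwmax y hy)))
    · exact Or.inr (hr _ (le_antisymm (hzmax w hw) (hwmax z hz)))
  · rintro (rfl | rfl)
    exacts [⟨hyP, hyD⟩, ⟨hzP, hzD⟩]

end Replacement

/-! ### Scarf's lemma by parity. -/

section Scarf

variable {V I : Type*} [Fintype I] [DecidableEq I] [DecidableEq V]

/-- If `P` does not carry all colors, the number of ways to delete an element leaving all colors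
but `i₀` is even. -/
theorem even_card_erase_image_eq (c : V → I) (i₀ : I) {P : Finset V}
    (hcard : P.card = Fintype.card I) (hP : P.image c ≠ Finset.univ) :
    Even (P.filter fun x => (P.erase x).image c = Finset.univ.erase i₀).card := by
  rcases (P.filter fun x => (P.erase x).image c = Finset.univ.erase i₀).eq_empty_or_nonempty with
    h | ⟨x, hx⟩
  · simp [h]
  obtain ⟨hxP, hx⟩ := Finset.mem_filter.1 hx
  have hcx : c x ≠ i₀ := by
    intro h
    apply hP
    rw [← Finset.insert_erase hxP, Finset.image_insert, hx, h,
      Finset.insert_erase (Finset.mem_univ _)]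
  -- The color of `x` thus recurs at exactly one other element `z`, and the admissible deletions are
  -- those of `x` and `z`.
  have hinj : Set.InjOn c (P.erase x : Finset V) := by
    rw [← Finset.card_image_iff, hx, Finset.card_erase_of_mem (Finset.mem_univ _),
      Finset.card_erase_of_mem hxP, hcard, Finset.card_univ]
  obtain ⟨z, hz, hzx⟩ := Finset.mem_image.1
    (hx ▸ Finset.mem_erase.2 ⟨hcx, Finset.mem_univ _⟩ : c x ∈ (P.erase x).image c)
  obtain ⟨hzx', hzP⟩ := Finset.mem_erase.1 hz
  have hz' : (P.erase z).image c = Finset.univ.erase i₀ := by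
    rw [← hx]
    ext a
    simp only [Finset.mem_image, Finset.mem_erase]
    constructor
    · rintro ⟨b, ⟨hbz, hb⟩, rfl⟩
      by_cases hbx : b = x
      · exact ⟨z, ⟨hzx', hzP⟩, by rw [hbx, hzx]⟩
      · exact ⟨b, ⟨hbx, hb⟩, rfl⟩
    · rintro ⟨b, ⟨hbx, hb⟩, rfl⟩
      by_cases hbz : b = z
      · exact ⟨x, ⟨hzx'.symm, hxP⟩, by rw [hbz, hzx]⟩
      · exact ⟨b, ⟨hbz, hb⟩, rfl⟩
  have : (P.filter fun x => (P.erase x).image c = Finset.univ.erase i₀) = {x, z} := by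
    ext w
    rw [Finset.mem_filter, Finset.mem_insert, Finset.mem_singleton]
    constructor
    · rintro ⟨hwP, hw⟩
      by_contra hcon
      push Not at hcon
      have hinj' : Set.InjOn c (P.erase w : Finset V) := by
        rw [← Finset.card_image_iff, hw, Finset.card_erase_of_mem (Finset.mem_univ _),
          Finset.card_erase_of_mem hwP, hcard, Finset.card_univ]
      exact hzx' (hinj' (Finset.mem_coe.2 (Finset.mem_erase.2 ⟨hcon.2.symm, hzP⟩))
        (Finset.mem_coe.2 (Finset.mem_erase.2 ⟨hcon.1.symm, hxP⟩)) hzx)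
    · rintro (rfl | rfl)
      exacts [⟨hxP, hx⟩, ⟨hzP, hz'⟩]
  rw [this, Finset.card_pair hzx'.symm]
  exact even_two

/-- **Scarf's lemma**: if the slack point `e i` is least for the ranking `r i` and above all proper
points for the other rankings, then every coloring giving `e i` the color `i` admits a dominant set
that carries each color exactly once. -/
theorem exists_dominant_rainbow [Fintype V] {r : I → V → ℕ} (hr : ∀ i, Function.Injective (r i))
    {e : I → V} (he : Function.Injective e) (hmin : ∀ i v, r i (e i) ≤ r i v)
    (hmax : ∀ l k, l ≠ k → ∀ v, v ∉ Set.range e → r l v < r l (e k))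
    (hproper : ∃ v, v ∉ Set.range e) (hI : 2 ≤ Fintype.card I) (c : V → I)
    (hc : ∀ i, c (e i) = i) :
    ∃ P : Finset V, Dominant r P ∧ P.card = Fintype.card I ∧ P.image c = Finset.univ := by
  classical
  by_contra hcon
  push Not at hcon
  obtain ⟨i₀⟩ : Nonempty I := Fintype.card_pos_iff.1 (by omega)
  let rooms : Finset (Finset V) :=
    Finset.univ.filter fun P => Dominant r P ∧ P.card = Fintype.card I
  let doors : Finset (Finset V) := Finset.univ.filter fun Q => Dominant r Q ∧
    Q.card + 1 = Fintype.card I ∧ Q.image c = Finset.univ.erase i₀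
  let below (P : Finset V) : Finset V :=
    P.filter fun x => (P.erase x).image c = Finset.univ.erase i₀
  let above (Q : Finset V) : Finset V :=
    Finset.univ.filter fun y => y ∉ Q ∧ Dominant r (insert y Q)
  -- Incidences of doors with rooms, counted both ways. Without a rainbow set each room has an even
  -- number of doors, whereas every door opens into two rooms except `Q₀`, which opens into one.
  have hcount : ∑ P ∈ rooms, (below P).card = ∑ Q ∈ doors, (above Q).card := by
    rw [← Finset.card_sigma, ← Finset.card_sigma]
    refine Finset.card_nbij' (fun a => ⟨a.1.erase a.2, a.2⟩) (fun a => ⟨insert a.2 a.1, a.2⟩)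
      ?_ ?_ ?_ ?_
    · rintro ⟨P, x⟩ h
      simp only [rooms, below, doors, above, Finset.mem_coe, Finset.mem_sigma, Finset.mem_filter,
        Finset.mem_univ, true_and] at h ⊢
      obtain ⟨⟨hD, hcd⟩, hx, him⟩ := h
      refine ⟨⟨hD.mono (Finset.erase_subset _ _), ?_, him⟩, Finset.notMem_erase _ _, ?_⟩
      · rw [Finset.card_erase_add_one hx, hcd]
      · rwa [Finset.insert_erase hx]
    · rintro ⟨Q, y⟩ h
      simp only [rooms, below, doors, above, Finset.mem_coe, Finset.mem_sigma, Finset.mem_filter,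
        Finset.mem_univ, true_and] at h ⊢
      obtain ⟨⟨hD, hcd, him⟩, hy, hD'⟩ := h
      refine ⟨⟨hD', ?_⟩, Finset.mem_insert_self _ _, ?_⟩
      · rw [Finset.card_insert_of_notMem hy, hcd]
      · rwa [Finset.erase_insert hy]
    · rintro ⟨P, x⟩ h
      simp only [below, Finset.mem_coe, Finset.mem_sigma, Finset.mem_filter] at h
      simp [Finset.insert_erase h.2.1]
    · rintro ⟨Q, y⟩ h
      simp only [above, Finset.mem_coe, Finset.mem_sigma, Finset.mem_filter] at h
      simp [Finset.erase_insert h.2.2.1]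
  have heven : Even (∑ P ∈ rooms, (below P).card) := by
    refine Finset.even_sum _ fun P hP => ?_
    obtain ⟨hD, hcd⟩ := (Finset.mem_filter.1 hP).2
    exact even_card_erase_image_eq c i₀ hcd (hcon P hD hcd)
  have hrange : ∀ v, v ∉ Set.range e → ∀ i, e i ≠ v := fun v hv i h => hv ⟨i, h⟩
  let Q₀ : Finset V := (Finset.univ.erase i₀).image e
  have hQ₀ : Q₀ ∈ doors := by
    refine Finset.mem_filter.2 ⟨Finset.mem_univ _, fun y => ?_, ?_, ?_⟩
    · by_cases hy : y ∈ Set.range e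
      · obtain ⟨l, rfl⟩ := hy
        exact ⟨l, fun x _ => hmin l x⟩
      · refine ⟨i₀, fun x hx => ?_⟩
        obtain ⟨k, hk, rfl⟩ := Finset.mem_image.1 hx
        exact (hmax i₀ k (Finset.ne_of_mem_erase hk).symm y hy).le
    · rw [Finset.card_image_of_injective _ he, Finset.card_erase_add_one (Finset.mem_univ _),
        Finset.card_univ]
    · rw [Finset.image_image]
      have : c ∘ e = id := funext hc
      rw [this, Finset.image_id]
  have hone : (above Q₀).card = 1 := by
    obtain ⟨v, hv⟩ := hproper
    obtain ⟨y, hy, hymax⟩ := Finset.exists_max_image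
      (Finset.univ.filter fun v => v ∉ Set.range e) (r i₀) ⟨v, by simpa using hv⟩
    replace hy : y ∉ Set.range e := (Finset.mem_filter.1 hy).2
    replace hymax : ∀ w, w ∉ Set.range e → r i₀ w ≤ r i₀ y := fun w hw =>
      hymax w (Finset.mem_filter.2 ⟨Finset.mem_univ _, hw⟩)
    rw [Finset.card_eq_one]
    refine ⟨y, Finset.ext fun w => ?_⟩
    simp only [above, Finset.mem_filter, Finset.mem_univ, true_and, Finset.mem_singleton]
    constructor
    · rintro ⟨hwQ, hwD⟩
      have hkey : ∀ u, u ∉ Set.range e → r i₀ u ≤ r i₀ w := fun u hu => by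
        obtain ⟨l, hl⟩ := hwD u
        by_cases hli : l = i₀
        · exact hli ▸ hl w (Finset.mem_insert_self _ _)
        · have h1 := hl (e l) (Finset.mem_insert_of_mem (Finset.mem_image_of_mem e
            (Finset.mem_erase.2 ⟨hli, Finset.mem_univ _⟩)))
          exact absurd (hr l (le_antisymm h1 (hmin l u))).symm (hrange u hu l)
      have hw : w ∉ Set.range e := by
        rintro ⟨l, rfl⟩
        by_cases hli : l = i₀
        · subst hli
          exact hrange v hv l (hr l (le_antisymm (hmin l v) (hkey v hv)))
        · exact hwQ (Finset.mem_image_of_mem e (Finset.mem_erase.2 ⟨hli, Finset.mem_univ _⟩))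
      exact hr i₀ (le_antisymm (hymax w hw) (hkey y hy))
    · rintro rfl
      refine ⟨fun h => ?_, fun u => ?_⟩
      · obtain ⟨k, -, hk⟩ := Finset.mem_image.1 h
        exact hrange w hy k hk
      · by_cases hu : u ∈ Set.range e
        · obtain ⟨l, rfl⟩ := hu
          exact ⟨l, fun x _ => hmin l x⟩
        · refine ⟨i₀, fun x hx => ?_⟩
          rcases Finset.mem_insert.1 hx with rfl | hx
          · exact hymax u hu
          · obtain ⟨k, hk, rfl⟩ := Finset.mem_image.1 hx
            exact (hmax i₀ k (Finset.ne_of_mem_erase hk).symm u hu).le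
  have htwo : ∀ Q ∈ doors.erase Q₀, Even (above Q).card := by
    intro Q hQ
    obtain ⟨hne, hQ⟩ := Finset.mem_erase.1 hQ
    obtain ⟨hD, hcd, him⟩ := (Finset.mem_filter.1 hQ).2
    have hQne : Q.Nonempty := Finset.card_pos.1 (by omega)
    rw [hD.card_insert_eq_two hr hQne hcd (fun k => ?_) (above Q) (by simp [above])]
    · exact even_two
    -- The slack point `e k` can fail only if `Q` consists of slack points alone, and then its
    -- colors force `Q = Q₀`.
    refine ⟨e k, fun l hl => ?_⟩
    by_contra hnot
    push Not at hnot
    have hsub : Q ⊆ Finset.univ.image e := fun x hx => by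
      by_contra hx'
      have hx'' : x ∉ Set.range e := by simpa using hx'
      exact absurd (hmax l k hl x hx'') (not_lt.2 (hnot x hx))
    refine hne (Finset.eq_of_subset_of_card_le (fun x hx => ?_) ?_)
    · obtain ⟨i, -, rfl⟩ := Finset.mem_image.1 (hsub hx)
      refine Finset.mem_image_of_mem e ?_
      have h := Finset.mem_image_of_mem c hx
      rwa [hc, him] at h
    · have := (Finset.mem_filter.1 hQ₀).2.2.1
      omega
  rw [hcount, ← Finset.add_sum_erase _ _ hQ₀, hone] at heven
  exact absurd (Finset.even_sum _ htwo) (by rw [Nat.even_add] at heven; simpa using heven)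

end Scarf

/-! ### Dominant sets of grid points. -/

/-- A labelled grid in the simplex `∑ i, x i = N` has a set `σ` of points that carry all the labels
in a nonempty set `C` and such that no grid point exceeds all of `σ` in all coordinates of `C`. -/
theorem exists_dominant_labelled_grid (m N : ℕ) (hm : 2 ≤ m)
    (c : {x : Fin m → ℕ // ∑ i, x i = N} → Fin m) :
    ∃ (C : Finset (Fin m)) (σ : Set {x : Fin m → ℕ // ∑ i, x i = N}), C.Nonempty ∧
      (∀ i ∈ C, ∃ s ∈ σ, c s = i) ∧
      ∀ y : {x : Fin m → ℕ // ∑ i, x i = N}, ∃ i ∈ C, ∀ s ∈ σ, y.1 i ≤ s.1 i := by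
  classical
  let T := {x : Fin m → ℕ // ∑ i, x i = N}
  have hle : ∀ (x : T) i, x.1 i ≤ N := fun x i =>
    (Finset.single_le_sum (fun _ _ => Nat.zero_le _) (Finset.mem_univ i)).trans x.2.le
  have : Finite T := Finite.of_injective (β := Fin m → Fin (N + 1))
    (fun x i => ⟨x.1 i, Nat.lt_succ_of_le (hle x i)⟩)
    (fun x y h => Subtype.ext (funext fun i => by simpa using congrFun h i))
  have : Fintype T := Fintype.ofFinite T
  let t := Fintype.equivFin T
  let M := Fintype.card T
  -- Grid points are ranked by their `i`-th coordinate, ties being broken by the enumeration `t`.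
  -- The summand 1 keeps them above the slack point of rank 0, and the other slack points lie above
  -- all of them.
  let r (i : Fin m) : T ⊕ Fin m → ℕ := Sum.elim (fun x => M * x.1 i + t x + 1)
    fun j => if i = j then 0 else M * (N + 1) + 1 + j
  have hlt : ∀ (x : T) i, M * x.1 i + t x < M * (N + 1) := fun x i => by
    have h1 : M * (x.1 i + 1) ≤ M * (N + 1) := Nat.mul_le_mul_left _ (Nat.succ_le_succ (hle x i))
    have h2 : (t x : ℕ) < M := (t x).2
    rw [Nat.mul_succ] at h1
    omega
  have hr : ∀ i, Function.Injective (r i) := by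
    rintro i (x | j) (y | k) h
    · simp only [r, Sum.elim_inl, Nat.add_right_cancel_iff] at h
      have h2 := congrArg (· % M) h
      have hx : (t x : ℕ) % M = t x := Nat.mod_eq_of_lt (t x).2
      have hy : (t y : ℕ) % M = t y := Nat.mod_eq_of_lt (t y).2
      simp only [Nat.mul_add_mod, hx, hy] at h2
      rw [t.injective (Fin.ext h2)]
    · simp only [r, Sum.elim_inl, Sum.elim_inr] at h
      have := hlt x i
      split_ifs at h; all_goals omega
    · simp only [r, Sum.elim_inl, Sum.elim_inr] at h
      have := hlt y i
      split_ifs at h; all_goals omega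
    · simp only [r, Sum.elim_inr] at h
      congr 1
      split_ifs at h with h1 h2 h2
      · rw [← h1, ← h2]
      · omega
      · omega
      · exact Fin.ext (by omega)
  have hproper : ∃ v : T ⊕ Fin m, v ∉ Set.range (Sum.inr : Fin m → T ⊕ Fin m) :=
    ⟨Sum.inl ⟨Pi.single ⟨0, by omega⟩ N, by simp⟩, by simp⟩
  obtain ⟨P, hD, hcard, himage⟩ := exists_dominant_rainbow hr
    (e := Sum.inr) Sum.inr_injective (fun i v => by simp [r])
    (fun l k hlk v hv => by
      rcases v with x | j
      · have := hlt x l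
        simp only [r, Sum.elim_inl, Sum.elim_inr, if_neg hlk]
        omega
      · exact absurd ⟨j, rfl⟩ hv)
    hproper (by simpa using hm) (Sum.elim c id) (fun i => rfl)
  have hkey : ∀ y : T, ∃ i, Sum.inr i ∉ P ∧ ∀ s : T, Sum.inl s ∈ P → y.1 i ≤ s.1 i := fun y => by
    obtain ⟨i, hi⟩ := hD (Sum.inl y)
    refine ⟨i, fun h => ?_, fun s hs => ?_⟩
    · have := hi _ h
      simp [r] at this
    · have h1 := hi _ hs
      simp only [r, Sum.elim_inl] at h1
      have h2 : (t s : ℕ) < M := (t s).2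
      by_contra! hcon
      have h3 : M * (s.1 i + 1) ≤ M * y.1 i := Nat.mul_le_mul_left _ hcon
      rw [Nat.mul_succ] at h3
      omega
  -- `C` consists of the indices whose slack point is not in `P`. A slack point in `P` is least in
  -- its own ranking, so that ranking cannot witness dominance at a grid point, and it supplies only
  -- its own color.
  refine ⟨Finset.univ.filter fun i => Sum.inr i ∉ P, {s | Sum.inl s ∈ P}, ?_, fun i hi => ?_,
    fun y => ?_⟩
  · obtain ⟨i, hi, -⟩ := hkey ⟨Pi.single ⟨0, by omega⟩ N, by simp⟩
    exact ⟨i, by simpa using hi⟩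
  · obtain ⟨v, hv, hvi⟩ := Finset.mem_image.1 (himage ▸ Finset.mem_univ i : i ∈ P.image _)
    rcases v with s | j
    · exact ⟨s, hv, hvi⟩
    · have : j = i := hvi
      exact absurd (this ▸ hv) (Finset.mem_filter.1 hi).2
  · obtain ⟨i, hi, h⟩ := hkey y
    exact ⟨i, by simpa using hi, fun s hs => h s hs⟩

/-- In the situation of `exists_dominant_labelled_grid` the points of `σ` are close together. -/
theorem grid_coord_lt_of_dominant {m N : ℕ} {C : Finset (Fin m)}
    {σ : Set {x : Fin m → ℕ // ∑ i, x i = N}} (hσ : σ.Nonempty)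
    (hD : ∀ y : {x : Fin m → ℕ // ∑ i, x i = N}, ∃ i ∈ C, ∀ s ∈ σ, y.1 i ≤ s.1 i) :
    ∃ a : Fin m → ℕ, (∀ i ∉ C, a i = 0) ∧ ∀ s ∈ σ, ∀ i, a i ≤ s.1 i ∧ s.1 i < a i + m := by
  classical
  choose b hb hbmin using fun i : Fin m =>
    (wellFounded_lt (α := ℕ)).has_min ((fun s => s.1 i) '' σ) (hσ.image _)
  have hble : ∀ s ∈ σ, ∀ i, b i ≤ s.1 i := fun s hs i =>
    not_lt.1 (hbmin i _ (Set.mem_image_of_mem _ hs))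
  have hCne : C.Nonempty := by
    obtain ⟨s, hs⟩ := hσ
    obtain ⟨i, hi, -⟩ := hD s
    exact ⟨i, hi⟩
  obtain ⟨i₀, hi₀⟩ := hCne
  have hsum : N < ∑ i ∈ C, (b i + 1) := by
    by_contra! hle
    -- If there were room, raising every minimum over `C` by 1 and putting the remaining mass at
    -- `i₀` would give a grid point that violates dominance.
    let y : Fin m → ℕ := (fun i => if i ∈ C then b i + 1 else 0) +
      Pi.single i₀ (N - ∑ i ∈ C, (b i + 1))
    have hy : ∑ i, y i = N := by
      simp only [y, Pi.add_apply, Finset.sum_add_distrib, Finset.sum_ite_mem, Finset.univ_inter,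
        Finset.sum_pi_single', Finset.mem_univ, if_true]
      rw [← Finset.sum_add_distrib]
      omega
    obtain ⟨i, hi, h⟩ := hD ⟨y, hy⟩
    obtain ⟨s, hs, hsb⟩ := hb i
    have h1 := h s hs
    simp only [y, Pi.add_apply, if_pos hi] at h1
    simp only at hsb
    omega
  rw [Finset.sum_add_distrib, Finset.sum_const, smul_eq_mul, mul_one] at hsum
  have hC : C.card ≤ m := (Finset.card_le_univ C).trans (by simp)
  -- The excesses `s i - a i` are nonnegative with total `N - ∑ a i < C.card ≤ m`, so each is less
  -- than `m`.
  refine ⟨fun i => if i ∈ C then b i else 0, fun i hi => if_neg hi, fun s hs i => ?_⟩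
  have hle : ∀ j, (if j ∈ C then b j else 0) ≤ s.1 j := fun j => by
    split_ifs
    · exact hble s hs j
    · exact Nat.zero_le _
  refine ⟨hle i, ?_⟩
  have h1 : ∑ j, (if j ∈ C then b j else 0) = ∑ j ∈ C, b j := by simp
  have h2 := Finset.add_sum_erase Finset.univ (fun j => if j ∈ C then b j else 0)
    (Finset.mem_univ i)
  have h3 := Finset.add_sum_erase Finset.univ s.1 (Finset.mem_univ i)
  have h4 : ∑ j ∈ Finset.univ.erase i, (if j ∈ C then b j else 0) ≤
      ∑ j ∈ Finset.univ.erase i, s.1 j := Finset.sum_le_sum fun j _ => hle j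
  have h5 := s.2
  dsimp only at h2 ⊢
  omega

/-! ### A KKM-type theorem for open covers of the simplex. -/

open scoped Fin.NatCast Fin.CommRing in
-- `finRotate` is a single cycle, so stepping backwards from one element reaches all.
theorem eq_univ_of_finRotate_closed {m : ℕ} {C : Finset (Fin m)} (hC : C.Nonempty)
    (h : ∀ i, finRotate m i ∈ C → i ∈ C) : C = Finset.univ := by
  obtain ⟨i, hi⟩ := hC
  obtain _ | m := m
  · exact i.elim0
  have hstep : ∀ k : ℕ, i - (k : Fin (m + 1)) ∈ C := by
    intro k
    induction k with
    | zero => simpa using hi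
    | succ k ih =>
      refine h _ ?_
      rw [finRotate_apply]
      convert ih using 1
      push_cast
      ring
  refine Finset.eq_univ_iff_forall.2 fun j => ?_
  have := hstep (i - j : Fin (m + 1)).val
  rwa [Fin.cast_val_eq_self, sub_sub_cancel] at this

/-- The point of the standard simplex given by a grid point. -/
noncomputable def gridPoint {m N : ℕ} (hN : N ≠ 0) (x : {x : Fin m → ℕ // ∑ i, x i = N}) :
    stdSimplex ℝ (Fin m) :=
  ⟨fun i => x.1 i / N, fun i => by positivity, by
    rw [← Finset.sum_div, ← Nat.cast_sum, x.2, div_self (Nat.cast_ne_zero.2 hN)]⟩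

theorem dist_gridPoint_lt {m N : ℕ} (hN : N ≠ 0) {δ : ℝ} (hδ : (m : ℝ) / N < δ)
    {x y : {x : Fin m → ℕ // ∑ i, x i = N}}
    (h : ∀ i, x.1 i ≤ y.1 i + m ∧ y.1 i ≤ x.1 i + m) :
    dist (gridPoint hN x) (gridPoint hN y) < δ := by
  have hN' : (0 : ℝ) < N := by positivity
  refine lt_of_le_of_lt ?_ hδ
  rw [Subtype.dist_eq, dist_pi_le_iff (by positivity)]
  intro i
  have h1 : (x.1 i : ℝ) ≤ y.1 i + m := by exact_mod_cast (h i).1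
  have h2 : (y.1 i : ℝ) ≤ x.1 i + m := by exact_mod_cast (h i).2
  have h3 : (gridPoint hN x).1 i - (gridPoint hN y).1 i = ((x.1 i : ℝ) - y.1 i) / N := by
    simp [gridPoint, sub_div]
  rw [Real.dist_eq, h3, abs_div, abs_of_pos hN']
  exact div_le_div_of_nonneg_right (abs_le.2 ⟨by linarith, by linarith⟩) hN'.le

/-- An open cover of the standard simplex, whose `i`-th member misses the `i`-th facet, has a point
common to all its members. -/
theorem stdSimplex_inter_nonempty_of_open_cover {m : ℕ} (hm : 2 ≤ m)
    (U : Fin m → Set (stdSimplex ℝ (Fin m))) (hU : ∀ i, IsOpen (U i)) (hcover : ∀ x, ∃ i, x ∈ U i)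
    (hfacet : ∀ i, ∀ x : stdSimplex ℝ (Fin m), x.1 i = 0 → x ∉ U i) : ∃ x, ∀ i, x ∈ U i := by
  obtain ⟨δ, hδ, hball⟩ := lebesgue_number_lemma_of_metric (isCompact_univ) hU
    (fun x _ => Set.mem_iUnion.2 (hcover x))
  obtain ⟨N, hN⟩ := exists_nat_gt ((m : ℝ) / δ)
  have hN0' : (0 : ℝ) < N := lt_of_le_of_lt (by positivity) hN
  have hN0 : N ≠ 0 := by
    rintro rfl
    simp at hN0'
  have hNδ : (m : ℝ) / N < δ := by
    rw [div_lt_iff₀ hδ] at hN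
    rw [div_lt_iff₀ hN0']
    linarith
  choose l hl using fun x : {x : Fin m → ℕ // ∑ i, x i = N} =>
    hball (gridPoint hN0 x) (Set.mem_univ _)
  obtain ⟨C, σ, hC, hcol, hD⟩ :=
    -- The labels are rotated because unrotated ones allow a trivial solution, such as a single grid
    -- point near vertex `i` with label `i` and `C = {i}`. After rotation, a label `i` outside `C`
    -- would be carried close to the `i`-th facet, which `U i` misses; this forces `C` to be
    -- everything.
    exists_dominant_labelled_grid m N hm fun x => finRotate m (l x)
  have hσ : σ.Nonempty := by
    obtain ⟨i, hi⟩ := hC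
    obtain ⟨s, hs, -⟩ := hcol i hi
    exact ⟨s, hs⟩
  obtain ⟨a, ha, haσ⟩ := grid_coord_lt_of_dominant hσ hD
  have hclosed : ∀ i, finRotate m i ∈ C → i ∈ C := by
    intro i hi
    by_contra hiC
    obtain ⟨s, hs, hsi⟩ := hcol _ hi
    replace hsi : l s = i := (finRotate m).injective hsi
    have hsm : s.1 i < m := by simpa [ha i hiC] using (haσ s hs i).2
    obtain ⟨j, hji⟩ : ∃ j : Fin m, j ≠ i :=
      haveI : Nontrivial (Fin m) := Fin.nontrivial_iff_two_le.2 hm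
      exists_ne i
    -- Moving the small coordinate `s i < m` onto another index gives a point of the `i`-th facet
    -- within the Lebesgue number of `s`.
    let q : {x : Fin m → ℕ // ∑ i, x i = N} :=
      ⟨fun k => if k = i then 0 else if k = j then s.1 j + s.1 i else s.1 k, by
        have h1 := Finset.add_sum_erase Finset.univ s.1 (Finset.mem_univ i)
        have hj : j ∈ Finset.univ.erase i := Finset.mem_erase.2 ⟨hji, Finset.mem_univ _⟩
        have h2 := Finset.add_sum_erase _ s.1 hj
        rw [← Finset.add_sum_erase _ _ (Finset.mem_univ i), ← Finset.add_sum_erase _ _ hj,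
          if_pos rfl, if_neg hji, if_pos rfl]
        have h3 : ∑ x ∈ (Finset.univ.erase i).erase j,
            (if x = i then 0 else if x = j then s.1 j + s.1 i else s.1 x) =
            ∑ x ∈ (Finset.univ.erase i).erase j, s.1 x := Finset.sum_congr rfl fun x hx => by
          simp only [Finset.mem_erase] at hx
          rw [if_neg hx.2.1, if_neg hx.1]
        rw [h3]
        have h4 := s.2
        omega⟩
    refine hfacet i (gridPoint hN0 q) (by simp [gridPoint, q]) (hsi ▸ hl s ?_)
    refine Metric.mem_ball.2 (dist_gridPoint_lt hN0 hNδ fun k => ?_)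
    simp only [q]
    split_ifs with h1 h2
    · subst h1
      omega
    · subst h2
      omega
    · omega
  have huniv := eq_univ_of_finRotate_closed hC hclosed
  obtain ⟨s, hs⟩ := hσ
  refine ⟨gridPoint hN0 s, fun i => ?_⟩
  obtain ⟨s', hs', hi⟩ := hcol (finRotate m i) (huniv ▸ Finset.mem_univ _)
  replace hi : l s' = i := (finRotate m).injective hi
  refine hi ▸ hl s' (Metric.mem_ball.2 (dist_gridPoint_lt hN0 hNδ fun k => ?_))
  have h1 := haσ s hs k
  have h2 := haσ s' hs' k
  omega

/-! ### Maps of a simplex carried by contractible sets. -/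

/-- A contraction of a subset `B` to a point, as a map on the ambient space. -/
theorem exists_contraction_of_contractibleSpace {X : Type*} [TopologicalSpace X] {B : Set X}
    (hB : ContractibleSpace B) :
    ∃ (F : X × ℝ → X) (b : X), b ∈ B ∧ ContinuousOn F (B ×ˢ Set.univ) ∧
      (∀ y ∈ B, ∀ t, F (y, t) ∈ B) ∧ (∀ y ∈ B, F (y, 0) = y) ∧ ∀ y ∈ B, F (y, 1) = b := by
  classical
  obtain ⟨b, ⟨H⟩⟩ := id_nullhomotopic B
  let F : X × ℝ → X := fun q => if h : q.1 ∈ B then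
    (H (Set.projIcc 0 1 zero_le_one q.2, ⟨q.1, h⟩) : X) else b
  have hF : ∀ (y : X) (hy : y ∈ B) (t : ℝ),
      F (y, t) = H (Set.projIcc 0 1 zero_le_one t, ⟨y, hy⟩) := fun y hy t => by
    simp only [F, dif_pos hy]
  refine ⟨F, b, b.2, ?_, fun y hy t => ?_, fun y hy => ?_, fun y hy => ?_⟩
  · rw [continuousOn_iff_continuous_domRestrict]
    have : Continuous fun q : (B ×ˢ Set.univ : Set (X × ℝ)) =>
        (H (Set.projIcc 0 1 zero_le_one q.1.2, ⟨q.1.1, q.2.1⟩) : X) := by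
      refine continuous_subtype_val.comp (H.continuous.comp (Continuous.prodMk ?_ ?_))
      · exact continuous_projIcc.comp (continuous_snd.comp continuous_subtype_val)
      · exact Continuous.subtype_mk (continuous_fst.comp continuous_subtype_val) _
    convert this using 1
    funext q
    exact hF q.1.1 q.2.1 q.1.2
  · rw [hF y hy]
    exact Subtype.coe_prop _
  · rw [hF y hy, Set.projIcc_left]
    simp
  · rw [hF y hy, Set.projIcc_right]
    simp

section Extension

variable {ι : Type*} [Fintype ι]

/-- The set of indices of the nonzero coordinates. -/
noncomputable def coordSupport (x : ι → ℝ) : Finset ι := by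
  classical exact Finset.univ.filter fun i => x i ≠ 0

theorem mem_coordSupport {x : ι → ℝ} {i : ι} : i ∈ coordSupport x ↔ x i ≠ 0 := by
  simp [coordSupport]

theorem coordSupport_subset_iff {x : ι → ℝ} {I : Finset ι} :
    coordSupport x ⊆ I ↔ ∀ i ∉ I, x i = 0 := by
  refine ⟨fun h i hi => ?_, fun h i hi => ?_⟩
  · by_contra hx
    exact hi (h (mem_coordSupport.2 hx))
  · by_contra hiI
    exact mem_coordSupport.1 hi (h i hiI)

theorem isClosed_coordSupport_subset (I : Finset ι) :
    IsClosed {x | x ∈ stdSimplex ℝ ι ∧ coordSupport x ⊆ I} := by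
  have : {x | x ∈ stdSimplex ℝ ι ∧ coordSupport x ⊆ I} =
      stdSimplex ℝ ι ∩ ⋂ i, ⋂ (_ : i ∉ I), {x | x i = 0} := by
    ext x
    simp [coordSupport_subset_iff]
  rw [this]
  exact (isClosed_stdSimplex ℝ ι).inter (isClosed_iInter fun i => isClosed_iInter fun _ =>
    isClosed_eq (continuous_apply i) continuous_const)

theorem isClosed_coordSupport_mem {F : Finset (Finset ι)}
    (hF : ∀ I ∈ F, ∀ J ⊆ I, J ∈ F) : IsClosed {x | x ∈ stdSimplex ℝ ι ∧ coordSupport x ∈ F} := by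
  have : {x | x ∈ stdSimplex ℝ ι ∧ coordSupport x ∈ F} =
      ⋃ I ∈ F, {x | x ∈ stdSimplex ℝ ι ∧ coordSupport x ⊆ I} := by
    ext x
    simp only [Set.mem_ofPred_eq, Set.mem_iUnion, exists_prop]
    exact ⟨fun h => ⟨_, h.2, h.1, subset_rfl⟩, fun ⟨I, hI, hx, hxI⟩ => ⟨hx, hF I hI _ hxI⟩⟩
  rw [this]
  exact F.finite_toSet.isClosed_biUnion fun I _ => isClosed_coordSupport_subset I

/-- The projection of a simplex with vertex set `I` from its barycenter to its boundary. -/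
noncomputable def radialProj [DecidableEq ι] (I : Finset ι) (μ : ℝ) (x : ι → ℝ) : ι → ℝ :=
  fun i => if i ∈ I then (x i - μ) / (1 - I.card * μ) else 0

theorem radialProj_mem [DecidableEq ι] {I : Finset ι} {μ : ℝ} {x : ι → ℝ} (hx : x ∈ stdSimplex ℝ ι)
    (hxI : coordSupport x ⊆ I) (hle : ∀ i ∈ I, μ ≤ x i) (hμ : I.card * μ < 1) :
    radialProj I μ x ∈ stdSimplex ℝ ι := by
  have hpos : 0 < 1 - I.card * μ := by linarith
  refine ⟨fun i => ?_, ?_⟩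
  · unfold radialProj
    split_ifs with hi
    · exact div_nonneg (by linarith [hle i hi]) hpos.le
    · exact le_rfl
  · have hsum : ∑ i ∈ I, x i = 1 := by
      rw [← hx.2]
      exact Finset.sum_subset (Finset.subset_univ I) fun i _ hi =>
        coordSupport_subset_iff.1 hxI i hi
    simp only [radialProj]
    rw [Finset.sum_ite_mem, Finset.univ_inter, ← Finset.sum_div, Finset.sum_sub_distrib, hsum,
      Finset.sum_const, nsmul_eq_mul, div_self hpos.ne']

theorem coordSupport_radialProj_ssubset [DecidableEq ι] {I : Finset ι} {μ : ℝ} {x : ι → ℝ}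
    (hμ : ∃ i ∈ I, x i = μ) : coordSupport (radialProj I μ x) ⊂ I := by
  obtain ⟨i, hi, hxi⟩ := hμ
  refine Finset.ssubset_iff_subset_ne.2 ⟨coordSupport_subset_iff.2 fun j hj => ?_, fun h => ?_⟩
  · simp [radialProj, hj]
  · exact mem_coordSupport.1 (h ▸ hi) (by simp [radialProj, hi, hxi])

variable {X : Type*} [TopologicalSpace X]

/-- Extension of a map over one more face with a contractible target. -/
theorem exists_extend_over_face [DecidableEq ι] {B : Finset ι → Set X} (hmono : Monotone B) {I : Finset ι}
    (hI : I.Nonempty) (hB : ContractibleSpace (B I)) {F : Finset (Finset ι)}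
    (hF : ∀ J ∈ F, ∀ K ⊆ J, K ∈ F) (hIF : I ∉ F) (hbd : ∀ J, J ⊂ I → J ∈ F)
    {g : (ι → ℝ) → X} (hg : ContinuousOn g {x | x ∈ stdSimplex ℝ ι ∧ coordSupport x ∈ F})
    (hgB : ∀ x ∈ stdSimplex ℝ ι, coordSupport x ∈ F → g x ∈ B (coordSupport x)) :
    ∃ f : (ι → ℝ) → X,
      ContinuousOn f {x | x ∈ stdSimplex ℝ ι ∧ coordSupport x ∈ insert I F} ∧
      ∀ x ∈ stdSimplex ℝ ι, coordSupport x ∈ insert I F → f x ∈ B (coordSupport x) := by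
  classical
  obtain ⟨H, b, hb, hH, hHB, hH0, hH1⟩ := exists_contraction_of_contractibleSpace hB
  let μ : (ι → ℝ) → ℝ := fun x => I.inf' hI x
  have hμc : Continuous μ := Continuous.finset_inf'_apply hI fun i _ => continuous_apply i
  have hμle : ∀ x, ∀ i ∈ I, μ x ≤ x i := fun x i hi => Finset.inf'_le _ hi
  have hμmem : ∀ x, ∃ i ∈ I, x i = μ x := fun x => by
    obtain ⟨i, hi, h⟩ := Finset.exists_mem_eq_inf' hI x
    exact ⟨i, hi, h.symm⟩
  -- `φ` is 0 on the boundary of the face and 2 at its barycenter. The factor 2 keeps the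
  -- denominator of the radial projection at least 1/2 on the collar `φ ≤ 1`.
  let φ : (ι → ℝ) → ℝ := fun x => 2 * (I.card * μ x)
  have hφc : Continuous φ := by fun_prop
  let r : (ι → ℝ) → (ι → ℝ) := fun x => radialProj I (μ x) x
  let D : Set (ι → ℝ) := {x | x ∈ stdSimplex ℝ ι ∧ coordSupport x ⊆ I}
  have hr : ∀ x ∈ D, φ x ≤ 1 → r x ∈ stdSimplex ℝ ι ∧ coordSupport (r x) ⊂ I := fun x hx h =>
    ⟨radialProj_mem hx.1 hx.2 (hμle x) (by simp only [φ] at h; linarith),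
      coordSupport_radialProj_ssubset (hμmem x)⟩
  have hgr : ∀ x ∈ D, φ x ≤ 1 → g (r x) ∈ B I := fun x hx h =>
    hmono (hr x hx h).2.subset (hgB _ (hr x hx h).1 (hbd _ (hr x hx h).2))
  have hrc : ContinuousOn r (D ∩ {x | φ x ≤ 1}) := by
    refine continuousOn_pi.2 fun i => ?_
    simp only [r, radialProj]
    split_ifs
    · refine ContinuousOn.div (by fun_prop) (by fun_prop) fun x hx => ?_
      have h : φ x ≤ 1 := hx.2
      simp only [φ] at h
      linarith
    · exact continuousOn_const
  -- On the collar, project to the boundary, apply `g`, and run the contraction up to time `φ x`; it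
  -- has reached `b` at `φ x = 1`, so the constant `b` fills the inside.
  let k : (ι → ℝ) → X := fun x => if φ x ≤ 1 then H (g (r x), φ x) else b
  have hkB : ∀ x ∈ D, k x ∈ B I := fun x hx => by
    simp only [k]
    split_ifs with h
    · exact hHB _ (hgr x hx h) _
    · exact hb
  have hkc : ContinuousOn k D := by
    have h1 : ContinuousOn k (D ∩ {x | φ x ≤ 1}) := by
      have : ContinuousOn (fun x => H (g (r x), φ x)) (D ∩ {x | φ x ≤ 1}) := by
        refine hH.comp (ContinuousOn.prodMk (hg.comp hrc fun x hx => ?_) hφc.continuousOn)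
          fun x hx => ⟨hgr x hx.1 hx.2, Set.mem_univ _⟩
        exact ⟨(hr x hx.1 hx.2).1, hbd _ (hr x hx.1 hx.2).2⟩
      exact this.congr fun x hx => if_pos hx.2
    have h2 : ContinuousOn k (D ∩ {x | 1 ≤ φ x}) := by
      refine (continuousOn_const (c := b)).congr fun x hx => ?_
      by_cases h : φ x ≤ 1
      · have h3 : φ x = 1 := le_antisymm h hx.2
        simp only [k, if_pos h]
        rw [h3, hH1 _ (hgr x hx.1 h)]
      · simp only [k, if_neg h]
    have hD : IsClosed D := isClosed_coordSupport_subset I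
    have := h1.union_of_isClosed h2 (hD.inter (isClosed_le hφc continuous_const))
      (hD.inter (isClosed_le continuous_const hφc))
    rw [← Set.inter_union_distrib_left] at this
    refine this.mono fun x hx => ⟨hx, le_total (φ x) 1⟩
  have hkg : ∀ x ∈ D, coordSupport x ∈ F → k x = g x := by
    intro x hx hxF
    have hne : coordSupport x ≠ I := fun h => hIF (h ▸ hxF)
    have hμ0 : μ x = 0 := by
      obtain ⟨i, hi, hiI⟩ : ∃ i ∈ I, i ∉ coordSupport x := by
        by_contra! hcon
        exact hne (hx.2.antisymm hcon)
      have hxi : x i = 0 := by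
        by_contra h
        exact hiI (mem_coordSupport.2 h)
      obtain ⟨j, -, hj⟩ := hμmem x
      exact le_antisymm (hxi ▸ hμle x i hi) (hj ▸ hx.1.1 j)
    have hφ0 : φ x = 0 := by simp [φ, hμ0]
    have hrx : r x = x := by
      funext i
      simp only [r, radialProj, hμ0]
      split_ifs with hi
      · simp
      · exact (coordSupport_subset_iff.1 hx.2 i hi).symm
    have hle : φ x ≤ 1 := by rw [hφ0]; exact zero_le_one
    have h := hgr x hx hle
    simp only [k, if_pos hle]
    rw [hφ0, hH0 _ h, hrx]
  let f : (ι → ℝ) → X := fun x => if coordSupport x ∈ F then g x else k x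
  have hfD : ∀ x ∈ D, f x = k x := fun x hx => by
    simp only [f]
    split_ifs with h
    · exact (hkg x hx h).symm
    · rfl
  refine ⟨f, ?_, fun x hx hxF => ?_⟩
  · have h1 : ContinuousOn f {x | x ∈ stdSimplex ℝ ι ∧ coordSupport x ∈ F} :=
      hg.congr fun x hx => if_pos hx.2
    refine (h1.union_of_isClosed (hkc.congr hfD) (isClosed_coordSupport_mem hF)
      (isClosed_coordSupport_subset I)).mono fun x hx => ?_
    rcases Finset.mem_insert.1 hx.2 with h | h
    · exact Or.inr ⟨hx.1, h.subset⟩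
    · exact Or.inl ⟨hx.1, h⟩
  · by_cases h : coordSupport x ∈ F
    · simp only [f, if_pos h]
      exact hgB x hx h
    · have hxI : coordSupport x = I := (Finset.mem_insert.1 hxF).resolve_right h
      simp only [f, if_neg h]
      rw [hxI]
      exact hkB x ⟨hx, hxI.subset⟩

/-- A monotone family of contractible sets indexed by the faces of a simplex carries a continuous
map defined on the simplex. -/
theorem exists_continuousMap_mem_carrier {B : Finset ι → Set X} (hmono : Monotone B)
    (hB : ∀ I, I.Nonempty → ContractibleSpace (B I)) :
    ∃ f : C(stdSimplex ℝ ι, X), ∀ x, f x ∈ B (coordSupport x.1) := by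
  classical
  have hne : ∀ x ∈ stdSimplex ℝ ι, (coordSupport x).Nonempty := fun x hx => by
    by_contra h
    rw [Finset.not_nonempty_iff_eq_empty] at h
    have := hx.2
    rw [Finset.sum_eq_zero fun i _ => coordSupport_subset_iff.1 h.subset i (by simp)] at this
    exact zero_ne_one this
  have key : ∀ (N : ℕ) (F : Finset (Finset ι)), F.card = N → (∀ J ∈ F, ∀ K ⊆ J, K ∈ F) →
      Nonempty X →
      ∃ f : (ι → ℝ) → X, ContinuousOn f {x | x ∈ stdSimplex ℝ ι ∧ coordSupport x ∈ F} ∧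
        ∀ x ∈ stdSimplex ℝ ι, coordSupport x ∈ F → f x ∈ B (coordSupport x) := by
    intro N
    induction N with
    | zero =>
      intro F hF _ ⟨x₀⟩
      rw [Finset.card_eq_zero] at hF
      subst hF
      exact ⟨fun _ => x₀, continuousOn_const, fun x _ h => absurd h (Finset.notMem_empty _)⟩
    | succ N ih =>
      intro F hcard hF hX
      -- Removing a maximal face leaves a family closed under subfaces that contains the whole
      -- boundary of that face.
      obtain ⟨I, hIF, hImax⟩ := F.exists_maximal (Finset.card_pos.1 (by omega))
      have hF' : ∀ J ∈ F.erase I, ∀ K ⊆ J, K ∈ F.erase I := fun J hJ K hKJ => by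
        obtain ⟨hJI, hJF⟩ := Finset.mem_erase.1 hJ
        refine Finset.mem_erase.2 ⟨?_, hF J hJF K hKJ⟩
        rintro rfl
        exact hJI (le_antisymm (hImax hJF hKJ) hKJ)
      obtain ⟨g, hg, hgB⟩ := ih (F.erase I) (by rw [Finset.card_erase_of_mem hIF]; omega) hF' hX
      rcases I.eq_empty_or_nonempty with rfl | hI
      · have h : ∀ x ∈ stdSimplex ℝ ι, coordSupport x ∈ F → coordSupport x ∈ F.erase ∅ :=
          fun x hx hxF => Finset.mem_erase.2 ⟨(hne x hx).ne_empty, hxF⟩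
        exact ⟨g, hg.mono fun x hx => ⟨hx.1, h x hx.1 hx.2⟩, fun x hx hxF => hgB x hx (h x hx hxF)⟩
      · have := exists_extend_over_face hmono hI (hB I hI) hF' (Finset.notMem_erase _ _)
          (fun J hJ => Finset.mem_erase.2 ⟨hJ.ne, hF I hIF J hJ.subset⟩) hg hgB
        rwa [Finset.insert_erase hIF] at this
  rcases isEmpty_or_nonempty (stdSimplex ℝ ι) with hemp | ⟨⟨x⟩⟩
  · exact ⟨⟨fun x => (hemp.false x).elim, continuous_of_const fun x => (hemp.false x).elim⟩,
      fun x => (hemp.false x).elim⟩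
  · have hX : Nonempty X := by
      have := hB _ (hne x.1 x.2)
      obtain ⟨y⟩ : Nonempty (B (coordSupport x.1)) := inferInstance
      exact ⟨y.1⟩
    obtain ⟨f, hf, hfB⟩ := key _ Finset.univ rfl (fun _ _ _ _ => Finset.mem_univ _) hX
    refine ⟨⟨fun x => f x.1, ?_⟩, fun x => hfB x.1 x.2 (Finset.mem_univ _)⟩
    exact hf.comp_continuous continuous_subtype_val fun x => ⟨x.2, Finset.mem_univ _⟩

end Extension

/-! ### Covering dimension and shrinking of covers. -/

theorem CoveringDimLE.mono {X : Type*} [TopologicalSpace X] {n k : ℕ} (h : CoveringDimLE X n)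
    (hnk : n ≤ k) : CoveringDimLE X k := fun 𝒰 hU hcover => by
  obtain ⟨𝒱, h1, h2, h3, h4⟩ := h 𝒰 hU hcover
  exact ⟨𝒱, h1, h2, h3, fun x => (h4 x).trans (by exact_mod_cast Nat.succ_le_succ hnk)⟩

theorem coveringDimLE_of_coveringDim_le {X : Type*} [TopologicalSpace X] [Nonempty X] {n : ℕ}
    (h : coveringDim X ≤ ((n : ℕ∞) : WithBot ℕ∞)) : CoveringDimLE X n := by
  by_contra hn
  have hle : (((n + 1 : ℕ) : ℕ∞) : WithBot ℕ∞) ≤ coveringDim X := by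
    rw [coveringDim, if_neg (not_isEmpty_of_nonempty X)]
    refine le_iInf₂ fun k hk => ?_
    have : n + 1 ≤ k := by
      by_contra! hlt
      exact hn (hk.mono (by omega))
    exact_mod_cast this
  have := hle.trans h
  norm_cast at this
  omega

/-- In a space of covering dimension less than `m - 1`, an open cover by `m` sets shrinks to one
whose members have no common point. -/
theorem CoveringDimLE.exists_shrinking {X : Type*} [TopologicalSpace X] {n m : ℕ}
    (h : CoveringDimLE X n) (hm : n + 2 ≤ m) {O : Fin m → Set X} (hO : ∀ i, IsOpen (O i))
    (hcover : ∀ x, ∃ i, x ∈ O i) :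
    ∃ W : Fin m → Set X, (∀ i, IsOpen (W i)) ∧ (∀ x, ∃ i, x ∈ W i) ∧ (∀ i, W i ⊆ O i) ∧
      ∀ x, ∃ i, x ∉ W i := by
  obtain ⟨𝒱, hopen, hcov, href, hmult⟩ := h (Set.range O) (by rintro _ ⟨i, rfl⟩; exact hO i)
    (Set.eq_univ_of_forall fun x => by
      obtain ⟨i, hi⟩ := hcover x
      exact ⟨O i, ⟨i, rfl⟩, hi⟩)
  have href' : ∀ V : 𝒱, ∃ i, V.1 ⊆ O i := fun V => by
    obtain ⟨_, ⟨i, rfl⟩, hi⟩ := href V.1 V.2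
    exact ⟨i, hi⟩
  choose ρ hρ using href'
  refine ⟨fun i => ⋃ V : 𝒱, ⋃ (_ : ρ V = i), V.1, fun i => ?_, fun x => ?_, fun i => ?_,
    fun x => ?_⟩
  · exact isOpen_iUnion fun V => isOpen_iUnion fun _ => hopen V.1 V.2
  · obtain ⟨V, hV, hx⟩ := (hcov ▸ Set.mem_univ x : x ∈ ⋃₀ 𝒱)
    exact ⟨ρ ⟨V, hV⟩, Set.mem_iUnion₂.2 ⟨⟨V, hV⟩, rfl, hx⟩⟩
  · refine Set.iUnion₂_subset fun V hV => ?_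
    rw [← hV]
    exact hρ V
  -- A point in every `W i` would lie in `m` members of the refinement, distinct because `ρ` sends
  -- them to different indices, against the multiplicity bound `n + 1 < m`.
  · by_contra! hall
    simp only [Set.mem_iUnion, exists_prop] at hall
    choose V hV hx using hall
    have hinj : Function.Injective fun i => (V i).1 := fun i j hij => by
      rw [← hV i, ← hV j, Subtype.ext hij]
    have h1 : Set.range (fun i => (V i).1) ⊆ {V ∈ 𝒱 | x ∈ V} := by
      rintro _ ⟨i, rfl⟩
      exact ⟨(V i).2, hx i⟩
    have h2 := (Set.encard_le_encard h1).trans (hmult x)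
    rw [← Set.image_univ, hinj.encard_image, Set.encard_univ, ENat.card_eq_coe_fintype_card, Fintype.card_fin] at h2
    have h3 : m ≤ n + 1 := by exact_mod_cast h2
    omega

/-! ### The Helly-type argument. -/

/-- In a Hausdorff space whose compact subsets have covering dimension at most `n`, at least `n + 2`
subsets have a common point if the whole space and the intersections of all proper subfamilies are
contractible. -/
theorem iInter_nonempty_of_contractible_proper {X : Type*} [TopologicalSpace X] [T2Space X] {n : ℕ}
    (hdim : ∀ K : Set X, IsCompact K → K.Nonempty → CoveringDimLE K n) {m : ℕ} (hm : n + 2 ≤ m)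
    (A : Fin m → Set X)
    (hA : ∀ I : Finset (Fin m), I ≠ Finset.univ → ContractibleSpace (⋂ i ∈ I, A i : Set X)) :
    (⋂ i, A i).Nonempty := by
  by_contra hempty
  have hmono : Monotone fun I : Finset (Fin m) => ⋂ i ∈ Iᶜ, A i := fun I J hIJ =>
    Set.biInter_subset_biInter_left fun i hi => Finset.compl_subset_compl.2 hIJ hi
  obtain ⟨f, hf⟩ := exists_continuousMap_mem_carrier hmono fun I hI => hA Iᶜ fun h => by
    rw [Finset.compl_eq_univ_iff] at h
    exact hI.ne_empty h
  have hfA : ∀ i, ∀ x : stdSimplex ℝ (Fin m), x.1 i = 0 → f x ∈ A i := fun i x hx => by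
    refine Set.mem_iInter₂.1 (hf x) i (Finset.mem_compl.2 fun h => mem_coordSupport.1 h hx)
  let K : Set X := Set.range f
  let f' : stdSimplex ℝ (Fin m) → K := Set.rangeFactorization f
  have hf' : Continuous f' := f.continuous.subtype_mk _
  let S (i : Fin m) : Set (stdSimplex ℝ (Fin m)) := {x | x.1 i = 0}
  -- Images of facets are compact, hence closed since `X` is Hausdorff. A point of `K` in all of
  -- them would be common to all `A i`.
  let O (i : Fin m) : Set K := (f' '' S i)ᶜ
  have hO : ∀ i, IsOpen (O i) := fun i => by
    have hS : IsClosed (S i) :=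
      isClosed_eq ((continuous_apply i).comp continuous_subtype_val) continuous_const
    exact ((hS.isCompact.image hf').isClosed).isOpen_compl
  have hcover : ∀ y, ∃ i, y ∈ O i := fun y => by
    by_contra! hy
    refine hempty ⟨y.1, Set.mem_iInter.2 fun i => ?_⟩
    obtain ⟨x, hx, hxy⟩ := Set.notMem_compl_iff.1 (hy i)
    rw [← hxy]
    exact hfA i x hx
  have hKne : K.Nonempty := by
    refine ⟨_, ⟨⟨Pi.single ⟨0, by omega⟩ 1, single_mem_stdSimplex ℝ _⟩, rfl⟩⟩
  obtain ⟨W, hW, hWcover, hWO, hWinter⟩ :=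
    (hdim K (isCompact_range f.continuous) hKne).exists_shrinking hm hO hcover
  obtain ⟨x, hx⟩ := stdSimplex_inter_nonempty_of_open_cover (by omega) (fun i => f' ⁻¹' W i)
    (fun i => (hW i).preimage hf') (fun x => hWcover (f' x))
    (fun i x hx hxW => hWO i hxW ⟨x, hx, rfl⟩)
  obtain ⟨i, hi⟩ := hWinter (f' x)
  exact hi (hx i)

theorem proposition2 {X : Type*} [TopologicalSpace X] [T2Space X] [ContractibleSpace X]
    (n : ℕ) (hdim : compactTopDim X = ((n : ℕ∞) : WithBot ℕ∞))
    (m : ℕ) (hm : n + 2 ≤ m) (A : Fin m → Set X)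
    (hA : ∀ i, ContractibleSpace (A i))
    (hinter : ∀ I : Finset (Fin m), I.Nonempty →
      ContractibleSpace (⋂ i ∈ I, A i : Set X) ∨ (⋂ i ∈ I, A i) = ∅)
    (hcommon : ∀ I : Finset (Fin m), I.card = n + 1 → (⋂ i ∈ I, A i).Nonempty) :
    (⋂ i, A i).Nonempty := by
  have hdim' : ∀ K : Set X, IsCompact K → K.Nonempty → CoveringDimLE K n := fun K hK hKne => by
    have := hKne.to_subtype
    refine coveringDimLE_of_coveringDim_le (le_of_le_of_eq ?_ hdim)
    exact le_iSup₂ (f := fun (K : Set X) (_ : IsCompact K) => coveringDim K) K hK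
  have key : ∀ (k : ℕ) (I : Finset (Fin m)), I.card = k → (⋂ i ∈ I, A i).Nonempty := by
    intro k
    induction k using Nat.strong_induction_on with
    | _ k ih =>
      intro I hI
      rcases Nat.lt_or_ge k (n + 2) with hk | hk
      -- Smaller subfamilies are enlarged to size `n + 1`, which is possible as `n + 2 ≤ m`.
      · obtain ⟨J, hIJ, hJ⟩ := Finset.exists_superset_card_eq (s := I) (n := n + 1) (by omega)
          (by rw [Fintype.card_fin]; omega)
        exact (hcommon J hJ).mono (Set.biInter_subset_biInter_left hIJ)
      · let e : Fin k ↪ Fin m := (I.orderEmbOfFin hI).toEmbedding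
        have he : Finset.univ.map e = I := Finset.map_orderEmbOfFin_univ I hI
        have hmap : ∀ J : Finset (Fin k), ⋂ i ∈ J, A (e i) = ⋂ i ∈ J.map e, A i := fun J => by
          simp
        have := iInter_nonempty_of_contractible_proper hdim' hk (fun i => A (e i)) fun J hJ => by
          -- The empty subfamily has intersection `X`; this is where contractibility of `X` enters.
          rcases J.eq_empty_or_nonempty with rfl | hJne
          · have h : ⋂ i ∈ (∅ : Finset (Fin k)), A (e i) = Set.univ := by simp
            rw [h]
            exact (Homeomorph.Set.univ X).contractibleSpace
          · rw [hmap]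
            refine (hinter (J.map e) (hJne.map)).resolve_right (Set.Nonempty.ne_empty ?_)
            refine ih J.card ?_ _ (Finset.card_map e)
            simpa using (Finset.card_lt_iff_ne_univ J).2 hJ
        rw [← he, ← hmap]
        simpa using this
  simpa using key _ Finset.univ rfl
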